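/- Let $B$ be a real Banach space with topological dual $B'$ and bidual $B''$, with $B\subseteq B''$ via the canonical embedding, and write $\langle\cdot,\cdot\rangle$ for the duality pairing. Let $A\in L(B'',B')$ be the covariance operator of a non-degenerate centered Radon Gaussian measure $\mathcal W$ on $B'$; that is, $\mathcal W$ is a Radon measure on $B'$ whose image under every $x''\in B''$ is a centered Gaussian measure on $\mathbb R$ (possibly a point mass), with variance $>0$ whenever $x''\neq 0$, and $\langle Ax'',y''\rangle=\int_{B'}\langle x'',x'\rangle\langle y'',x'\rangle\,\mathrm d\mathcal W(x')$ for all $x'',y''\in B''$. Let $\varphi\in\Phi_\infty^+$, i.e. $\varphi(t)=\int_{[0,\infty)}e^{-st}\,\mathrm d\nu(s)$ for $t\ge 0$, where $\nu$ is a finite Borel measure on $[0,\infty)$ with $\nu\ne0$ and $\operatorname{supp}\nu\neq\{0\}$. Then $$k(x,y):=\varphi\big(\langle A(x-y),x-y\rangle\big),\qquad x,y\in B\subseteq B'',$$ is a measurable kernel (a symmetric, positive definite function) on $B$ that is integrally strictly positive definite with respect to the set $\mathcal M^*(B)$ of all finite signed Radon measures on $B$. That is, with $H_k$ the reproducing kernel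 Hilbert space of $k$, for every $\mu\in\mathcal M^*(B)$ all functions in $H_k$ are measurable and $\mu$-integrable, the kernel mean embedding $\Phi_k(\mu)\in H_k$, defined by $\langle f,\Phi_k(\mu)\rangle_{H_k}=\int f\,\mathrm d\mu$ for all $f\in H_k$, exists, and $$\|\Phi_k(\mu)\|_{H_k}^2=\int_B\int_B k(x,y)\,\mathrm d\mu(x)\,\mathrm d\mu(y),$$ and this number is $>0$ whenever $\mu\neq 0$. -/

import Mathlib

open MeasureTheory ProbabilityTheory
open scoped NNReal

noncomputable section

universe u

/-! ### Kernels and signed measures -/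

section Kernels

variable {X : Type u}

/-- A kernel on `X`: a symmetric, positive (semi-)definite function `X × X → ℝ`. -/
def IsKernel (k : X → X → ℝ) : Prop :=
  (∀ x y, k x y = k y x) ∧
    ∀ (n : ℕ) (c : Fin n → ℝ) (x : Fin n → X), 0 ≤ ∑ i, ∑ j, c i * c j * k (x i) (x j)

/-- The Hilbert space `H` of real-valued functions on `X` has the reproducing kernel `k`:
`k (·, y)` is the representer of the evaluation at `y`. -/
def HasReproducingKernel (H : Type u) [NormedAddCommGroup H] [InnerProductSpace ℝ H]
    [CompleteSpace H] [RKHS ℝ H X ℝ] (k : X → X → ℝ) : Prop :=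
  ∀ x y, RKHS.kernel H x y (1 : ℝ) = k x y

variable [MeasurableSpace X]

/-- The integral `∫ f dμ = ∫ f dμ⁺ - ∫ f dμ⁻` against a finite signed measure. -/
def signedIntegral (μ : SignedMeasure X) (f : X → ℝ) : ℝ :=
  ∫ x, f x ∂μ.toJordanDecomposition.posPart - ∫ x, f x ∂μ.toJordanDecomposition.negPart

/-- The double integral `∫ ∫ k (x, y) dμ(x) dμ(y)`. -/
def doubleIntegral (k : X → X → ℝ) (μ : SignedMeasure X) : ℝ :=
  signedIntegral μ fun y => signedIntegral μ fun x => k x y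

/-- The finite signed measures `μ` such that every function in the reproducing kernel Hilbert
space of `k` is measurable and `μ`-integrable. -/
def embeddableMeasures (k : X → X → ℝ) : Set (SignedMeasure X) :=
  {μ | ∀ (H : Type u) [NormedAddCommGroup H] [InnerProductSpace ℝ H] [CompleteSpace H]
    [RKHS ℝ H X ℝ], HasReproducingKernel H k →
      ∀ f : H, Measurable (fun x => f x) ∧ Integrable (fun x => f x) μ.totalVariation}

/-- `i` is the kernel mean embedding of `μ`, that is, the Pettis integral of `x ↦ k (·, x)`
against `μ`. By the reproducing property, `⟪f, k (·, x)⟫ = f x`. -/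
def IsKernelMeanEmbedding {H : Type u} [NormedAddCommGroup H] [InnerProductSpace ℝ H]
    [CompleteSpace H] [RKHS ℝ H X ℝ] (μ : SignedMeasure X) (i : H) : Prop :=
  ∀ f : H, inner ℝ f i = signedIntegral μ fun x => f x

/-- `k` is a measurable kernel that is integrally strictly positive definite with respect to the
set `M` of finite signed measures: all `μ ∈ M` have a kernel mean embedding, and its squared norm
`‖μ‖² = ∫ ∫ k (x, y) dμ(x) dμ(y)` in the reproducing kernel Hilbert space of `k` is positive
unless `μ = 0`. -/
structure IsIntegrallyStrictlyPosDef (k : X → X → ℝ) (M : Set (SignedMeasure X)) : Prop where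
  isKernel : IsKernel k
  measurable : Measurable (Function.uncurry k)
  subset_embeddable : M ⊆ embeddableMeasures k
  sq_norm_embedding : ∀ μ ∈ M, ∀ (H : Type u) [NormedAddCommGroup H] [InnerProductSpace ℝ H]
    [CompleteSpace H] [RKHS ℝ H X ℝ], HasReproducingKernel H k →
      ∃ i : H, IsKernelMeanEmbedding μ i ∧ ‖i‖ ^ 2 = doubleIntegral k μ
  pos : ∀ μ ∈ M, μ ≠ 0 → 0 < doubleIntegral k μ

/-- The finite signed Radon measures on `X`: the total variation is inner and outer regular. -/
def radonSignedMeasures (X : Type u) [TopologicalSpace X] [MeasurableSpace X] :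
    Set (SignedMeasure X) :=
  {μ | μ.totalVariation.Regular}

end Kernels

/-! ### Laplace transforms -/

/-- The Laplace transforms `t ↦ ∫ exp (-s t) dν(s)`, `t ≥ 0`, of the finite Borel measures `ν` on
`[0, ∞)` with `ν ≠ 0` and `supp ν ≠ {0}`. Only the values of the function on `[0, ∞)` matter. -/
def PhiInftyPlus : Set (ℝ → ℝ) :=
  {φ | ∃ ν : Measure ℝ≥0, IsFiniteMeasure ν ∧ ν ≠ 0 ∧ ν.support ≠ {0} ∧
    ∀ t : ℝ, 0 ≤ t → φ t = ∫ s, Real.exp (-((s : ℝ) * t)) ∂ν}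

/-! ### Gaussian measures -/

section Gaussian

variable {E : Type u} [NormedAddCommGroup E] [NormedSpace ℝ E] [MeasurableSpace E]

/-- A centered Radon Gaussian measure on `E`: a Radon measure all of whose images under
continuous linear functionals are centered Gaussian measures on `ℝ`. -/
structure IsCenteredRadonGaussian (W : Measure E) : Prop where
  regular : W.Regular
  isGaussian : IsGaussian W
  centered : ∀ L : StrongDual ℝ E, ∫ x, L x ∂W = 0

/-- `W` is non-degenerate: no non-zero continuous linear functional has variance zero. -/
def IsNondegenerateGaussian (W : Measure E) : Prop :=
  ∀ L : StrongDual ℝ E, L ≠ 0 → 0 < Var[fun x => L x; W]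

/-- `A : E' → E` is the covariance operator of `W`: `⟨A L, M⟩ = Cov (L, M)` for `L, M ∈ E'`. -/
def IsCovarianceOperator (A : StrongDual ℝ E →L[ℝ] E) (W : Measure E) : Prop :=
  ∀ L M : StrongDual ℝ E, M (A L) = cov[fun x => L x, fun x => M x; W]

end Gaussian

/-- The kernel `k (x, y) = φ (⟨A (x - y), x - y⟩)` on `B`, with `B` embedded into its bidual. -/
def covarianceKernel {B : Type u} [NormedAddCommGroup B] [NormedSpace ℝ B]
    (A : StrongDual ℝ (StrongDual ℝ B) →L[ℝ] StrongDual ℝ B) (φ : ℝ → ℝ) (x y : B) : ℝ :=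
  φ (A (NormedSpace.inclusionInDoubleDual ℝ B (x - y)) (x - y))

end

-- The kernel is a mixture over `ν` of the Gaussian kernels `exp (-s ⟨A (x - y), x - y⟩)`, and each
-- of these is the characteristic function of `W`, rescaled by `√(2s)`. Hence `k` has a bounded
-- feature map of cosines and sines into some `L²(Q)`, and Fubini turns the double integral into `∫
-- (∫ g dμ)² dQ ≥ 0` (`doubleIntegral_eq`).
--
-- If this vanishes, so does `∫ g dμ` almost everywhere. Since `ν` charges `(0, ∞)`, some single `s
-- > 0` inherits this (`exists_pos_of_ae`), so the convolution of `μ` with the Gaussian function of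
-- parameter `s` is identically zero. Expanding the square, the measures `μ⁺` and `μ⁻` weighted by
-- `exp (-s ⟨A x, x⟩)` have the same Laplace transform along `A`. Analytic continuation gives equal
-- Fourier transforms, and non-degeneracy of `A` gives `μ⁺ = μ⁻`.
--
-- Measurability and Fourier uniqueness need `B` separable: a non-degenerate Radon measure forces
-- `B'`, hence `B`, to be separable.

universe u

/-! ### Kernels with a bounded feature map and their mean embeddings. -/

section FeatureKernels

variable {X : Type u} [MeasurableSpace X] {Ω : Type*} [MeasurableSpace Ω]

theorem signedIntegral_add (μ : SignedMeasure X) {f g : X → ℝ}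
    (hf : Integrable f μ.totalVariation) (hg : Integrable g μ.totalVariation) :
    signedIntegral μ (fun x => f x + g x) = signedIntegral μ f + signedIntegral μ g := by
  unfold SignedMeasure.totalVariation at hf hg
  unfold signedIntegral
  rw [integral_add hf.left_of_add_measure hg.left_of_add_measure,
    integral_add hf.right_of_add_measure hg.right_of_add_measure]
  ring

theorem signedIntegral_const_mul (μ : SignedMeasure X) (c : ℝ) (f : X → ℝ) :
    signedIntegral μ (fun x => c * f x) = c * signedIntegral μ f := by
  simp only [signedIntegral, integral_const_mul]
  ring

instance isFiniteMeasure_totalVariation (μ : SignedMeasure X) :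
    IsFiniteMeasure μ.totalVariation := by
  unfold SignedMeasure.totalVariation
  infer_instance

theorem abs_signedIntegral_le (μ : SignedMeasure X) {f : X → ℝ} {C : ℝ} (hC : ∀ x, |f x| ≤ C) :
    |signedIntegral μ f| ≤ C * (μ.toJordanDecomposition.posPart.real Set.univ +
      μ.toJordanDecomposition.negPart.real Set.univ) := by
  have h (m : Measure X) [IsFiniteMeasure m] : |∫ x, f x ∂m| ≤ C * m.real Set.univ :=
    norm_integral_le_of_norm_le_const (μ := m) (f := f) (.of_forall fun x => hC x)
  calc _ ≤ _ := abs_sub _ _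
    _ ≤ _ := add_le_add (h _) (h _)
    _ = _ := by ring

theorem integrable_of_measurable_of_abs_le {μ : Measure X} [IsFiniteMeasure μ] {f : X → ℝ}
    (hf : Measurable f) {C : ℝ} (hC : ∀ x, |f x| ≤ C) : Integrable f μ :=
  .of_bound hf.aestronglyMeasurable C (.of_forall hC)

theorem measurable_signedIntegral (μ : SignedMeasure X) {g : Ω → X → ℝ}
    (hg : Measurable (Function.uncurry g)) : Measurable fun ω => signedIntegral μ (g ω) :=
  (hg.stronglyMeasurable.integral_prod_right).measurable.sub
    (hg.stronglyMeasurable.integral_prod_right).measurable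

/-- Fubini's theorem for a signed measure and a bounded integrand. -/
theorem signedIntegral_integral_mul (μ : SignedMeasure X) {Q : Measure Ω} [IsFiniteMeasure Q]
    {g : Ω → X → ℝ} (hg : Measurable (Function.uncurry g)) (hg1 : ∀ ω x, |g ω x| ≤ 1)
    {h : Ω → ℝ} (hh : Measurable h) {C : ℝ} (hC : ∀ ω, |h ω| ≤ C) :
    signedIntegral μ (fun x => ∫ ω, g ω x * h ω ∂Q) =
      ∫ ω, signedIntegral μ (g ω) * h ω ∂Q := by
  have key (m : Measure X) [IsFiniteMeasure m] :
      ∫ x, ∫ ω, g ω x * h ω ∂Q ∂m = ∫ ω, (∫ x, g ω x ∂m) * h ω ∂Q ∧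
      Integrable (fun ω => (∫ x, g ω x ∂m) * h ω) Q := by
    have hi : Integrable (fun p : Ω × X => g p.1 p.2 * h p.1) (Q.prod m) := by
      refine integrable_of_measurable_of_abs_le (C := 1 * C)
        (hg.mul (hh.comp measurable_fst)) fun p => ?_
      rw [abs_mul]
      exact mul_le_mul (hg1 _ _) (hC _) (abs_nonneg _) zero_le_one
    constructor
    · rw [← integral_integral_swap (f := fun ω x => g ω x * h ω) hi]
      simp only [integral_mul_const]
    · simpa only [integral_mul_const] using hi.integral_prod_left
  unfold signedIntegral
  rw [(key _).1, (key _).1, ← integral_sub (key _).2 (key _).2]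
  simp only [sub_mul]

variable {Q : Measure Ω} {g : Ω → X → ℝ} {k : X → X → ℝ}

/-- The kernel with bounded measurable feature map `x ↦ g (·, x)` into `L²(Q)`. -/
structure IsFeatureKernel (Q : Measure Ω) (g : Ω → X → ℝ) (k : X → X → ℝ) : Prop where
  measurable_feature : Measurable (Function.uncurry g)
  abs_le_one : ∀ ω x, |g ω x| ≤ 1
  eq_integral : ∀ x y, k x y = ∫ ω, g ω x * g ω y ∂Q

namespace IsFeatureKernel

theorem measurable_right (hk : IsFeatureKernel Q g k) (x : X) : Measurable fun ω => g ω x :=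
  hk.measurable_feature.comp (measurable_id.prodMk measurable_const)

variable [IsFiniteMeasure Q]

theorem integrable_mul (hk : IsFeatureKernel Q g k) (x y : X) :
    Integrable (fun ω => g ω x * g ω y) Q := by
  refine integrable_of_measurable_of_abs_le (C := 1 * 1)
    ((hk.measurable_right x).mul (hk.measurable_right y)) fun p => ?_
  rw [abs_mul]
  exact mul_le_mul (hk.abs_le_one _ _) (hk.abs_le_one _ _) (abs_nonneg _) zero_le_one

theorem isKernel (hk : IsFeatureKernel Q g k) : IsKernel k := by
  refine ⟨fun x y => by simp only [hk.eq_integral, mul_comm], fun n c x => ?_⟩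
  have h : ∑ i, ∑ j, c i * c j * k (x i) (x j) = ∫ ω, (∑ i, c i * g ω (x i)) ^ 2 ∂Q := by
    simp only [sq, Finset.sum_mul_sum]
    have hi (i j : Fin n) : Integrable (fun ω => c i * g ω (x i) * (c j * g ω (x j))) Q := by
      convert (hk.integrable_mul (x i) (x j)).const_mul (c i * c j) using 2
      ring
    rw [integral_finsetSum _ fun i _ => integrable_finsetSum _ fun j _ => hi i j]
    refine Finset.sum_congr rfl fun i _ => ?_
    rw [integral_finsetSum _ fun j _ => hi i j]
    refine Finset.sum_congr rfl fun j _ => ?_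
    rw [hk.eq_integral, ← integral_const_mul]
    congr with ω
    ring
  rw [h]
  exact integral_nonneg fun ω => sq_nonneg _

theorem measurable (hk : IsFeatureKernel Q g k) : Measurable (Function.uncurry k) := by
  have h : Function.uncurry k = fun p : X × X => ∫ ω, g ω p.1 * g ω p.2 ∂Q := by
    ext p
    exact hk.eq_integral _ _
  rw [h]
  have hm : Measurable fun q : (X × X) × Ω => g q.2 q.1.1 * g q.2 q.1.2 :=
    (hk.measurable_feature.comp (measurable_snd.prodMk (measurable_fst.comp measurable_fst))).mul
      (hk.measurable_feature.comp (measurable_snd.prodMk (measurable_snd.comp measurable_fst)))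
  exact hm.stronglyMeasurable.integral_prod_right.measurable

theorem abs_apply_le (hk : IsFeatureKernel Q g k) (x y : X) : |k x y| ≤ Q.real Set.univ := by
  rw [hk.eq_integral, ← one_mul (Q.real Set.univ)]
  refine norm_integral_le_of_norm_le_const (μ := Q) (f := fun ω => g ω x * g ω y) (.of_forall fun ω => ?_)
  rw [Real.norm_eq_abs, abs_mul]
  exact mul_le_one₀ (hk.abs_le_one _ _) (abs_nonneg _) (hk.abs_le_one _ _)

theorem signedIntegral_apply (hk : IsFeatureKernel Q g k) (μ : SignedMeasure X) (y : X) :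
    signedIntegral μ (fun x => k x y) = ∫ ω, signedIntegral μ (g ω) * g ω y ∂Q := by
  simp only [hk.eq_integral]
  exact signedIntegral_integral_mul μ hk.measurable_feature hk.abs_le_one (hk.measurable_right y)
    fun ω => hk.abs_le_one ω y

theorem doubleIntegral_eq (hk : IsFeatureKernel Q g k) (μ : SignedMeasure X) :
    doubleIntegral k μ = ∫ ω, signedIntegral μ (g ω) ^ 2 ∂Q := by
  unfold doubleIntegral
  simp only [hk.signedIntegral_apply, mul_comm (signedIntegral μ (g _)), sq]
  exact signedIntegral_integral_mul μ hk.measurable_feature hk.abs_le_one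
    (measurable_signedIntegral μ hk.measurable_feature)
    fun ω => abs_signedIntegral_le μ (hk.abs_le_one ω)

theorem doubleIntegral_nonneg (hk : IsFeatureKernel Q g k) (μ : SignedMeasure X) :
    0 ≤ doubleIntegral k μ := by
  rw [hk.doubleIntegral_eq]
  exact integral_nonneg fun ω => sq_nonneg _

theorem ae_signedIntegral_eq_zero (hk : IsFeatureKernel Q g k) {μ : SignedMeasure X}
    (h : doubleIntegral k μ = 0) : ∀ᵐ ω ∂Q, signedIntegral μ (g ω) = 0 := by
  rw [hk.doubleIntegral_eq, integral_eq_zero_iff_of_nonneg (fun ω => sq_nonneg _)] at h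
  · filter_upwards [h] with ω hω
    simpa using hω
  · refine integrable_of_measurable_of_abs_le (C := (1 *
      (μ.toJordanDecomposition.posPart.real Set.univ +
        μ.toJordanDecomposition.negPart.real Set.univ)) ^ 2)
      ((measurable_signedIntegral μ hk.measurable_feature).pow_const 2) fun ω => ?_
    rw [abs_pow]
    exact pow_le_pow_left₀ (abs_nonneg _) (abs_signedIntegral_le μ (hk.abs_le_one ω)) 2

section RKHS

variable {H : Type u} [NormedAddCommGroup H] [InnerProductSpace ℝ H] [CompleteSpace H]
  [RKHS ℝ H X ℝ]

omit [MeasurableSpace X] in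
theorem _root_.HasReproducingKernel.kerFun_apply (hH : HasReproducingKernel H k) (x y : X)
    (c : ℝ) : RKHS.kerFun H y c x = c * k x y := by
  rw [RKHS.kerFun_apply, ← hH, ← smul_eq_mul, ← map_smul, smul_eq_mul, mul_one]

theorem abs_apply_rkhs_le (hk : IsFeatureKernel Q g k) (hH : HasReproducingKernel H k) (f : H)
    (x : X) : |f x| ≤ √(Q.real Set.univ) * ‖f‖ := by
  have h : ‖RKHS.kernel H x x‖ ≤ Q.real Set.univ := by
    refine ContinuousLinearMap.opNorm_le_bound _ measureReal_nonneg fun c => ?_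
    rw [← RKHS.kerFun_apply, hH.kerFun_apply, norm_mul, mul_comm]
    exact mul_le_mul_of_nonneg_right (hk.abs_apply_le x x) (norm_nonneg _)
  rw [mul_comm]
  exact (RKHS.norm_apply_le f x).trans
    (mul_le_mul_of_nonneg_left (Real.sqrt_le_sqrt h) (norm_nonneg _))

theorem measurable_rkhs (hk : IsFeatureKernel Q g k) (hH : HasReproducingKernel H k) (f : H) :
    Measurable fun x => f x := by
  have hspan : ∀ f ∈ Submodule.span ℝ {RKHS.kerFun H x v | (x) (v)}, Measurable fun x => f x := by
    intro f hf
    induction hf using Submodule.span_induction with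
    | mem f hf =>
      obtain ⟨y, c, rfl⟩ := hf
      simp only [hH.kerFun_apply]
      exact (hk.measurable.comp (measurable_id.prodMk measurable_const)).const_mul c
    | zero => simp
    | add f g _ _ hf hg => simpa using Measurable.fun_add hf hg
    | smul c f _ hf => simpa using hf.const_mul c
  have hf : f ∈ closure (Submodule.span ℝ {RKHS.kerFun H x v | (x) (v)} : Set H) := by
    rw [← Submodule.topologicalClosure_coe, RKHS.kerFun_dense]
    trivial
  obtain ⟨F, hF, hFf⟩ := mem_closure_iff_seq_limit.1 hf
  -- Norm convergence in an RKHS implies pointwise convergence.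
  refine measurable_of_tendsto_metrizable (fun n => hspan _ (hF n)) (tendsto_pi_nhds.2 fun x => ?_)
  exact ((RKHS.continuous_eval x).tendsto f).comp hFf

theorem integrable_rkhs (hk : IsFeatureKernel Q g k) (hH : HasReproducingKernel H k) (f : H)
    (m : Measure X) [IsFiniteMeasure m] : Integrable (fun x => f x) m :=
  integrable_of_measurable_of_abs_le (hk.measurable_rkhs hH f) (hk.abs_apply_rkhs_le hH f)

/-- Riesz representation: `f ↦ ∫ f dμ` is bounded on `H` because `|f x| ≤ √Q(Ω) ‖f‖`. -/
theorem exists_isKernelMeanEmbedding (hk : IsFeatureKernel Q g k) (hH : HasReproducingKernel H k)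
    (μ : SignedMeasure X) : ∃ i : H, IsKernelMeanEmbedding μ i := by
  let T : H →ₗ[ℝ] ℝ :=
    { toFun := fun f => signedIntegral μ fun x => f x
      map_add' := fun f g => by
        simpa using signedIntegral_add μ (hk.integrable_rkhs hH f _) (hk.integrable_rkhs hH g _)
      map_smul' := fun c f => by
        simpa using signedIntegral_const_mul μ c fun x => f x }
  let L : H →L[ℝ] ℝ := T.mkContinuous (√(Q.real Set.univ) *
      (μ.toJordanDecomposition.posPart.real Set.univ +
        μ.toJordanDecomposition.negPart.real Set.univ)) fun f => by
    refine (abs_signedIntegral_le μ (hk.abs_apply_rkhs_le hH f)).trans_eq ?_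
    ring
  refine ⟨(InnerProductSpace.toDual ℝ H).symm L, fun f => ?_⟩
  rw [real_inner_comm, InnerProductSpace.toDual_symm_apply]
  rfl

/-- Testing against `k (·, y)` gives `i y = ∫ k (x, y) dμ(x)`; testing against `i` itself then gives
the norm. -/
theorem _root_.IsKernelMeanEmbedding.sq_norm_eq (hH : HasReproducingKernel H k)
    {μ : SignedMeasure X} {i : H} (hi : IsKernelMeanEmbedding μ i) :
    ‖i‖ ^ 2 = doubleIntegral k μ := by
  rw [← real_inner_self_eq_norm_sq, hi i, doubleIntegral]
  congr with y
  have h := hi (RKHS.kerFun H y 1)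
  rw [RKHS.kerFun_inner] at h
  simpa [hH.kerFun_apply] using h

end RKHS

/-- A kernel with bounded measurable feature map is integrally strictly positive definite once
it is strictly positive on all non-zero measures. -/
theorem isIntegrallyStrictlyPosDef (hk : IsFeatureKernel Q g k) {M : Set (SignedMeasure X)}
    (hM : ∀ μ ∈ M, doubleIntegral k μ = 0 → μ = 0) : IsIntegrallyStrictlyPosDef k M where
  isKernel := hk.isKernel
  measurable := hk.measurable
  subset_embeddable := fun _ _ _ _ _ _ _ hH f =>
    ⟨hk.measurable_rkhs hH f, hk.integrable_rkhs hH f _⟩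
  sq_norm_embedding := fun μ _ _ _ _ _ _ hH => by
    obtain ⟨i, hi⟩ := hk.exists_isKernelMeanEmbedding hH μ
    exact ⟨i, hi, hi.sq_norm_eq hH⟩
  pos := fun μ hμ h0 =>
    (hk.doubleIntegral_nonneg μ).lt_of_ne fun h => h0 (hM μ hμ h.symm)

end IsFeatureKernel

end FeatureKernels

/-! ### Separability from Hahn–Banach. -/

section Separability

open Set TopologicalSpace

variable {E : Type u} [NormedAddCommGroup E] [NormedSpace ℝ E]

theorem exists_dual_ne_zero_of_closure_span_ne_univ {s : Set E}
    (hs : closure (Submodule.span ℝ s : Set E) ≠ univ) :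
    ∃ L : StrongDual ℝ E, L ≠ 0 ∧ ∀ x ∈ s, L x = 0 := by
  obtain ⟨x, hx⟩ := (ne_univ_iff_exists_notMem _).1 hs
  obtain ⟨L, r, hL, hr⟩ := geometric_hahn_banach_closed_point
    (Submodule.span ℝ s).topologicalClosure.convex isClosed_closure hx
  have h0 : 0 < r := by simpa using hL 0 (subset_closure (Submodule.zero_mem _))
  refine ⟨L, ?_, fun y hy => ?_⟩
  · rintro rfl
    exact (h0.trans hr).false
  -- A functional bounded above on a subspace vanishes there: otherwise some multiple of `y` attains
  -- the strict bound `r`.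
  · by_contra h
    have := hL ((r / L y) • y)
      (subset_closure (Submodule.smul_mem _ _ (Submodule.subset_span hy)))
    rw [map_smul, smul_eq_mul, div_mul_cancel₀ _ h] at this
    exact this.false

theorem separableSpace_of_closure_span_eq_univ {s : Set E} (hs : IsSeparable s)
    (h : closure (Submodule.span ℝ s : Set E) = univ) : SeparableSpace E := by
  rw [← isSeparable_univ_iff, ← h]
  exact (hs.span (R := ℝ)).closure

/-- A normed space with separable dual is separable. -/
theorem separableSpace_of_separableSpace_dual [SeparableSpace (StrongDual ℝ E)] :
    SeparableSpace E := by
  have hx (L : StrongDual ℝ E) : ∃ x : E, ‖x‖ ≤ 1 ∧ ‖L‖ / 2 ≤ ‖L x‖ := by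
    rcases eq_or_ne L 0 with rfl | hL
    · exact ⟨0, by simp⟩
    · obtain ⟨x, hx, hx'⟩ := L.exists_lt_apply_of_lt_opNorm
        (half_lt_self (norm_pos_iff.2 hL))
      exact ⟨x, hx.le, hx'.le⟩
  choose x hx1 hx2 using hx
  have hc := countable_range fun n => x (denseSeq (StrongDual ℝ E) n)
  refine separableSpace_of_closure_span_eq_univ hc.isSeparable (by_contra fun h => ?_)
  obtain ⟨L, hL, hLx⟩ := exists_dual_ne_zero_of_closure_span_ne_univ h
  obtain ⟨n, hn⟩ := (denseRange_denseSeq (StrongDual ℝ E)).exists_dist_lt L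
    (show 0 < ‖L‖ / 4 by have := norm_pos_iff.2 hL; positivity)
  set M := denseSeq (StrongDual ℝ E) n
  rw [dist_eq_norm] at hn
  have h1 : ‖M (x M)‖ ≤ ‖L - M‖ := by
    have h := (L - M).le_opNorm_of_le (hx1 M)
    rw [sub_apply, hLx _ ⟨n, rfl⟩, zero_sub, norm_neg, mul_one] at h
    exact h
  have h2 := hx2 M
  have h3 := norm_sub_norm_le L M
  have h4 := norm_nonneg L
  -- `3‖L‖/8 < ‖M‖/2 ≤ ‖M (x M)‖ ≤ ‖L - M‖ < ‖L‖/4` is absurd.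
  linarith

/-- A finite Radon measure for which no non-zero functional vanishes almost everywhere lives on
a separable space. -/
theorem separableSpace_of_regular [MeasurableSpace E] [BorelSpace E] {W : Measure E}
    [IsFiniteMeasure W] (hW : W.Regular)
    (h0 : ∀ L : StrongDual ℝ E, (∀ᵐ x ∂W, L x = 0) → L = 0) : SeparableSpace E := by
  have hK (n : ℕ) : ∃ K, IsCompact K ∧ W Kᶜ ≤ ((n : ENNReal) + 1)⁻¹ := by
    obtain ⟨K, -, hK, h⟩ := MeasurableSet.univ.exists_isCompact_isClosed_sdiff_lt
      (measure_ne_top W univ) (ε := ((n : ENNReal) + 1)⁻¹) (by simp)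
    exact ⟨K, hK, by simpa [← compl_eq_univ_sdiff] using h.2.le⟩
  choose K hKc hKW using hK
  refine separableSpace_of_closure_span_eq_univ
    (IsSeparable.iUnion fun n => (hKc n).isSeparable) (by_contra fun h => ?_)
  obtain ⟨L, hL, hLK⟩ := exists_dual_ne_zero_of_closure_span_ne_univ h
  -- `L` vanishes on every `K n`, so `{L ≠ 0}` has measure at most `1 / (n + 1)` for all `n`.
  refine hL (h0 L (le_antisymm (ge_of_tendsto' (ENNReal.tendsto_inv_nat_nhds_zero.comp
    (Filter.tendsto_add_atTop_nat 1)) fun n => ?_) bot_le))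
  refine (measure_mono (t := (K n)ᶜ) fun x (hx : ¬ L x = 0) hxK =>
    hx (hLK x (mem_iUnion.2 ⟨n, hxK⟩))).trans
    ((hKW n).trans_eq ?_)
  simp

end Separability

/-! ### From Laplace to Fourier transforms. -/

section Laplace

open Complex

/-- An mgf finite on all of `ℝ` extends to an entire function, so its real values determine the
value at `I`. -/
theorem complexMGF_I_eq_of_mgf_eq {Ω : Type*} [MeasurableSpace Ω] {P P' : Measure Ω}
    [IsFiniteMeasure P] [IsFiniteMeasure P'] {Y : Ω → ℝ}
    (hi : ∀ t : ℝ, Integrable (fun x => Real.exp (t * Y x)) P) (h : mgf Y P = mgf Y P') :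
    complexMGF Y P I = complexMGF Y P' I := by
  have h0 : P = 0 ↔ P' = 0 := by
    have h1 := congr_fun h 0
    simp only [mgf_zero'] at h1
    rw [← Measure.measure_univ_eq_zero, ← Measure.measure_univ_eq_zero,
      ← measureReal_eq_zero_iff, ← measureReal_eq_zero_iff, h1]
  refine eqOn_complexMGF_of_mgf' h h0 ?_
  have : integrableExpSet Y P = Set.univ := Set.eq_univ_of_forall hi
  simp [this]

/-- Finite measures on a separable Banach space are determined by their Laplace transforms along
a symmetric bilinear form without isotropic vectors. -/
theorem ext_of_forall_integral_exp_eq {V : Type*} [NormedAddCommGroup V] [NormedSpace ℝ V]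
    [CompleteSpace V] [SecondCountableTopology V] [MeasurableSpace V] [BorelSpace V]
    (b : V →L[ℝ] StrongDual ℝ V) (hb : ∀ v, v ≠ 0 → b v ≠ 0)
    {P P' : Measure V} [IsFiniteMeasure P] [IsFiniteMeasure P']
    (hi : ∀ w, Integrable (fun v => Real.exp (b v w)) P)
    (h : ∀ w, ∫ v, Real.exp (b v w) ∂P = ∫ v, Real.exp (b v w) ∂P') : P = P' := by
  have hc : Continuous fun p : V × V => b p.1 p.2 := by fun_prop
  refine ext_of_integral_char_eq (L := b.toLinearMap₁₂) Real.continuous_probChar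
    Real.probChar_ne_one ?_ hc fun w => ?_
  · intro v hv h
    refine hb v hv ?_
    ext w
    exact LinearMap.congr_fun h w
  · have := complexMGF_I_eq_of_mgf_eq (P := P) (P' := P') (Y := fun v => b v w)
      (fun t => by simpa using hi (t • w)) (funext fun t => by simpa [mgf] using h (t • w))
    simp only [complexMGF, mul_comm I] at this
    exact this

end Laplace

/-! ### Jordan parts and invertible densities. -/

section WeightedMeasures

variable {X : Type u} [MeasurableSpace X]

theorem signedMeasure_eq_zero_of_posPart_eq_negPart {μ : SignedMeasure X}
    (h : μ.toJordanDecomposition.posPart = μ.toJordanDecomposition.negPart) : μ = 0 := by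
  rw [← μ.toSignedMeasure_toJordanDecomposition, JordanDecomposition.toSignedMeasure]
  simp only [h, sub_self]

theorem eq_of_withDensity_eq {m m' : Measure X} {f : X → ENNReal} (hf : Measurable f)
    (h0 : ∀ x, f x ≠ 0) (htop : ∀ x, f x ≠ ⊤) (h : m.withDensity f = m'.withDensity f) :
    m = m' := by
  rw [← withDensity_inv_same (μ := m) hf (.of_forall h0) (.of_forall htop), h,
    withDensity_inv_same hf (.of_forall h0) (.of_forall htop)]

end WeightedMeasures

/-! ### Gaussian kernels: injectivity and random Fourier features. -/

section GaussianKernels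

variable {B : Type u} [NormedAddCommGroup B] [NormedSpace ℝ B] [MeasurableSpace B]

/-- A signed measure whose convolution with a non-degenerate Gaussian function vanishes is zero. -/
theorem eq_zero_of_signedIntegral_gaussian_eq_zero [CompleteSpace B] [BorelSpace B]
    [SecondCountableTopology B] (b : B →L[ℝ] StrongDual ℝ B) (hsymm : ∀ x y, b x y = b y x)
    (hpos : ∀ x, x ≠ 0 → 0 < b x x) {s : ℝ} (hs : 0 < s) {μ : SignedMeasure B}
    (h : ∀ y, signedIntegral μ (fun x => Real.exp (-(s * b (x - y) (x - y)))) = 0) : μ = 0 := by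
  have hnn (x : B) : 0 ≤ b x x := by
    rcases eq_or_ne x 0 with rfl | hx
    · simp
    · exact (hpos x hx).le
  set ρ : B → ENNReal := fun x => ENNReal.ofReal (Real.exp (-(s * b x x))) with hρ
  have hρm : Measurable ρ := by
    have : Continuous fun x => Real.exp (-(s * b x x)) := by fun_prop
    exact this.measurable.ennreal_ofReal
  have hρt (x : B) : (ρ x).toReal = Real.exp (-(s * b x x)) :=
    ENNReal.toReal_ofReal (Real.exp_nonneg _)
  -- Completing the square at `y = w / (2s)`, where the cross term `2s b(x, y)` equals `b(x, w)`.
  have hshift (x w : B) : (ρ x).toReal * Real.exp (b x w) =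
      Real.exp (s * b ((2 * s)⁻¹ • w) ((2 * s)⁻¹ • w)) *
        Real.exp (-(s * b (x - (2 * s)⁻¹ • w) (x - (2 * s)⁻¹ • w))) := by
    rw [hρt, ← Real.exp_add, ← Real.exp_add]
    congr 1
    simp only [map_sub, sub_apply, map_smul, smul_apply, smul_eq_mul,
      hsymm w x]
    field_simp
    ring
  have hint (y : B) (m : Measure B) [IsFiniteMeasure m] :
      Integrable (fun x => Real.exp (-(s * b (x - y) (x - y)))) m := by
    have hc : Continuous fun x => Real.exp (-(s * b (x - y) (x - y))) := by fun_prop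
    refine integrable_of_measurable_of_abs_le hc.measurable (C := 1) fun x => ?_
    rw [abs_of_nonneg (Real.exp_nonneg _), Real.exp_le_one_iff, neg_nonpos]
    exact mul_nonneg hs.le (hnn _)
  have hfin (m : Measure B) [IsFiniteMeasure m] : IsFiniteMeasure (m.withDensity ρ) := by
    refine isFiniteMeasure_withDensity_ofReal ?_
    simpa using (hint 0 m).2
  have := hfin μ.toJordanDecomposition.posPart
  have := hfin μ.toJordanDecomposition.negPart
  refine signedMeasure_eq_zero_of_posPart_eq_negPart (eq_of_withDensity_eq hρm
    (fun x => by simp [hρ, Real.exp_pos]) (fun x => by simp [hρ]) ?_)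
  refine ext_of_forall_integral_exp_eq b (fun v hv h0 => ?_) (fun w => ?_) fun w => ?_
  · have := hpos v hv
    simp [h0] at this
  · rw [integrable_withDensity_iff_integrable_smul' hρm (.of_forall fun x => by simp [hρ])]
    simp only [smul_eq_mul, hshift]
    exact (hint _ _).const_mul _
  · rw [integral_withDensity_eq_integral_toReal_smul hρm (.of_forall fun x => by simp [hρ]),
      integral_withDensity_eq_integral_toReal_smul hρm (.of_forall fun x => by simp [hρ])]
    simp only [smul_eq_mul, hshift, integral_const_mul]
    rw [sub_eq_zero.1 (h ((2 * s)⁻¹ • w))]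

/-- The phase which turns cosines into sines. -/
noncomputable def phase (i : Bool) : ℝ := bif i then 0 else Real.pi / 2

/-- The random Fourier feature of the Gaussian kernel with inverse width `s`. -/
noncomputable def fourierFeature (s : ℝ≥0) (w : StrongDual ℝ B × Bool) (x : B) : ℝ :=
  Real.cos (√(2 * s) * w.1 x - phase w.2)

variable [BorelSpace B] [SecondCountableTopology B]

theorem measurable_fourierFeature :
    Measurable fun p : (ℝ≥0 × (StrongDual ℝ B × Bool)) × B => fourierFeature p.1.1 p.1.2 p.2 := by
  have h1 : Measurable fun p : StrongDual ℝ B × B => p.1 p.2 :=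
    isBoundedBilinearMap_apply.continuous.measurable
  have h2 : Measurable phase := measurable_from_top
  have h3 : Measurable fun s : ℝ≥0 => √(2 * (s : ℝ)) := by fun_prop
  have h4 : Measurable fun p : (ℝ≥0 × (StrongDual ℝ B × Bool)) × B => p.1.2.1 p.2 :=
    h1.comp (by fun_prop : Measurable fun p : (ℝ≥0 × (StrongDual ℝ B × Bool)) × B =>
      (p.1.2.1, p.2))
  unfold fourierFeature
  exact Real.measurable_cos.comp (((h3.comp (by fun_prop)).mul h4).sub (h2.comp (by fun_prop)))

theorem measurable_fourierFeature_mul (x y : B) :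
    Measurable fun p : ℝ≥0 × (StrongDual ℝ B × Bool) =>
      fourierFeature p.1 p.2 x * fourierFeature p.1 p.2 y := by
  have h (z : B) : Measurable fun p : ℝ≥0 × (StrongDual ℝ B × Bool) => fourierFeature p.1 p.2 z :=
    measurable_fourierFeature.comp
      (f := fun p : ℝ≥0 × (StrongDual ℝ B × Bool) => (p, z)) (by fun_prop)
  exact (h x).mul (h y)

omit [MeasurableSpace B] [BorelSpace B] [SecondCountableTopology B] in
theorem abs_fourierFeature_mul_le (s : ℝ≥0) (w : StrongDual ℝ B × Bool) (x y : B) :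
    |fourierFeature s w x * fourierFeature s w y| ≤ 1 := by
  rw [abs_mul]
  exact mul_le_one₀ (Real.abs_cos_le_one _) (abs_nonneg _) (Real.abs_cos_le_one _)

omit [MeasurableSpace B] [BorelSpace B] [SecondCountableTopology B] in
-- Real part of the Gaussian characteristic function; the factor `√(2s)` cancels the `1/2` in its
-- exponent.
theorem integral_cos_eq_exp {W : Measure (StrongDual ℝ B)} [IsGaussian W]
    (hW : ∀ L : StrongDual ℝ (StrongDual ℝ B), ∫ x, L x ∂W = 0) (s : ℝ≥0) (z : B) :
    ∫ w : StrongDual ℝ B, Real.cos (√(2 * s) * w z) ∂W =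
      Real.exp (-(s * Var[fun w => w z; W])) := by
  have h := IsGaussian.charFunDual_eq (μ := W)
    (√(2 * s) • NormedSpace.inclusionInDoubleDual ℝ B z)
  have hv : Var[⇑(√(2 * s) • NormedSpace.inclusionInDoubleDual ℝ B z); W] =
      2 * s * Var[fun w => w z; W] := by
    have := variance_const_mul (√(2 * s)) (fun w : StrongDual ℝ B => w z) W
    rw [Real.sq_sqrt (by positivity)] at this
    exact this
  rw [hv, charFunDual_apply, integral_complex_ofReal, hW] at h
  have hi : Integrable (fun w : StrongDual ℝ B => Complex.exp
      ((√(2 * s) • NormedSpace.inclusionInDoubleDual ℝ B z) w * Complex.I)) W :=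
    .of_bound (by fun_prop) 1 (.of_forall fun w => by rw [Complex.norm_exp_ofReal_mul_I])
  have hre := congr_arg Complex.re h
  rw [← RCLike.re_eq_complex_re, ← integral_re hi] at hre
  simp only [RCLike.re_eq_complex_re, Complex.exp_ofReal_mul_I_re] at hre
  refine hre.trans ?_
  rw [← Complex.exp_ofReal_re]
  congr 2
  push_cast
  ring

theorem isFeatureKernel_exp {W : Measure (StrongDual ℝ B)} [IsGaussian W]
    (hW : ∀ L : StrongDual ℝ (StrongDual ℝ B), ∫ x, L x ∂W = 0) (s : ℝ≥0) :
    IsFeatureKernel (W.prod Measure.count) (fourierFeature (B := B) s)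
      fun x y => Real.exp (-(s * Var[fun w => w (x - y); W])) where
  measurable_feature := measurable_fourierFeature.comp
    (f := fun p : (StrongDual ℝ B × Bool) × B => ((s, p.1), p.2)) (by fun_prop)
  abs_le_one := fun w x => Real.abs_cos_le_one _
  eq_integral := fun x y => by
    have hi : Integrable (fun w => fourierFeature s w x * fourierFeature s w y)
        (W.prod Measure.count) :=
      integrable_of_measurable_of_abs_le
        ((measurable_fourierFeature_mul x y).comp
          (f := fun w : StrongDual ℝ B × Bool => (s, w)) (by fun_prop))
        fun w => abs_fourierFeature_mul_le s w x y
    rw [integral_prod _ hi, ← integral_cos_eq_exp hW]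
    congr with w
    -- The sum over the two phases is `cos a cos b + sin a sin b = cos (a - b)`.
    simp only [integral_countable .of_finite, fourierFeature, phase]
    simp [mul_sub, Real.cos_sub]

/-- Mixtures of Gaussian kernels have a feature map. -/
theorem isFeatureKernel_mixture {W : Measure (StrongDual ℝ B)} [IsGaussian W]
    (hW : ∀ L : StrongDual ℝ (StrongDual ℝ B), ∫ x, L x ∂W = 0) (ν : Measure ℝ≥0)
    [IsFiniteMeasure ν] :
    IsFeatureKernel (ν.prod (W.prod Measure.count))
      (fun (p : ℝ≥0 × (StrongDual ℝ B × Bool)) (x : B) => fourierFeature p.1 p.2 x)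
      fun x y => ∫ s : ℝ≥0, Real.exp (-(s * Var[fun w => w (x - y); W])) ∂ν where
  measurable_feature := measurable_fourierFeature
  abs_le_one := fun w x => Real.abs_cos_le_one _
  eq_integral := fun x y => by
    rw [integral_prod _ (integrable_of_measurable_of_abs_le (measurable_fourierFeature_mul x y)
      fun p => abs_fourierFeature_mul_le p.1 p.2 x y)]
    congr with s
    exact (isFeatureKernel_exp hW s).eq_integral x y

end GaussianKernels

/-- Otherwise `ν` would be concentrated at `0` and, being non-zero, have support exactly `{0}`. -/
theorem exists_pos_of_ae {ν : Measure ℝ≥0} (h0 : ν ≠ 0) (hs : ν.support ≠ {0}) {p : ℝ≥0 → Prop}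
    (hp : ∀ᵐ s ∂ν, p s) : ∃ s, 0 < s ∧ p s := by
  by_contra! h
  have h1 : {0} ∈ ae ν := by
    filter_upwards [hp] with s hps
    by_contra hs0
    exact h s (pos_iff_ne_zero.2 hs0) hps
  refine hs (subset_antisymm (Measure.support_subset_of_isClosed isClosed_singleton h1) ?_)
  rintro _ rfl
  refine (Measure.mem_support_iff_forall 0).2 fun U hU => pos_iff_ne_zero.2 fun hU0 => h0 ?_
  have h2 : U ∈ ae ν := by
    filter_upwards [h1] with s hs0
    rw [Set.mem_singleton_iff.1 hs0]
    exact mem_of_mem_nhds hU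
  rw [← Measure.measure_univ_eq_zero, ← Set.union_compl_self U]
  exact measure_union_null hU0 h2

theorem mainTheorem3 {B : Type*} [NormedAddCommGroup B] [NormedSpace ℝ B] [CompleteSpace B]
    [MeasurableSpace B] [BorelSpace B]
    (A : StrongDual ℝ (StrongDual ℝ B) →L[ℝ] StrongDual ℝ B)
    (hA : ∃ W : Measure (StrongDual ℝ B), IsCenteredRadonGaussian W ∧
      IsNondegenerateGaussian W ∧ IsCovarianceOperator A W)
    (φ : ℝ → ℝ) (hφ : φ ∈ PhiInftyPlus) :
    IsIntegrallyStrictlyPosDef (covarianceKernel A φ) (radonSignedMeasures B) := by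
  obtain ⟨W, ⟨hreg, hG, hcent⟩, hnd, hcov⟩ := hA
  obtain ⟨ν, hνfin, hν0, hνs, hφν⟩ := hφ
  have : TopologicalSpace.SeparableSpace (StrongDual ℝ B) := by
    refine separableSpace_of_regular hreg fun L hL => by_contra fun hL0 => (hnd L hL0).ne' ?_
    rw [variance_congr (Y := 0) hL, variance_zero]
  have : TopologicalSpace.SeparableSpace B := separableSpace_of_separableSpace_dual
  have := UniformSpace.secondCountable_of_separable B
  let b : B →L[ℝ] StrongDual ℝ B := A.comp (NormedSpace.inclusionInDoubleDual ℝ B)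
  have hb (x y : B) : b x y = cov[fun w => w x, fun w => w y; W] :=
    hcov (NormedSpace.inclusionInDoubleDual ℝ B x) (NormedSpace.inclusionInDoubleDual ℝ B y)
  have hvar (x : B) : b x x = Var[fun w => w x; W] := by
    rw [hb, covariance_self]
    exact (ContinuousLinearMap.measurable_apply x).aemeasurable
  have hpos (x : B) (hx : x ≠ 0) : 0 < b x x := by
    rw [hvar]
    refine hnd (NormedSpace.inclusionInDoubleDual ℝ B x) fun h => hx ?_
    exact (NormedSpace.inclusionInDoubleDualLi ℝ).injective
      (h.trans (NormedSpace.inclusionInDoubleDual ℝ B).map_zero.symm)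
  have hk : covarianceKernel A φ =
      fun x y => ∫ s : ℝ≥0, Real.exp (-(s * Var[fun w => w (x - y); W])) ∂ν := by
    ext x y
    rw [← hvar]
    refine hφν _ ?_
    change 0 ≤ b (x - y) (x - y)
    rw [hvar]
    exact variance_nonneg _ _
  have hF := isFeatureKernel_mixture hcent ν
  rw [← hk] at hF
  refine hF.isIntegrallyStrictlyPosDef fun μ _ h0 => ?_
  obtain ⟨s, hs, hs0⟩ := exists_pos_of_ae hν0 hνs
    (Measure.ae_ae_of_ae_prod (hF.ae_signedIntegral_eq_zero h0))
  refine eq_zero_of_signedIntegral_gaussian_eq_zero b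
    (fun x y => by rw [hb, hb, covariance_comm]) hpos (s := s) hs fun y => ?_
  simp only [hvar]
  -- The convolution at `y` is the `L²` pairing of the vanishing transform of `μ` with the feature
  -- of `y`.
  rw [(isFeatureKernel_exp hcent s).signedIntegral_apply]
  refine integral_eq_zero_of_ae ?_
  filter_upwards [hs0] with w hw
  simp [hw]
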